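/- A (descriptor) system with $m$ inputs, $p$ outputs and state dimension $n$ is a tuple $S=(E,A,B,C,D)$ of real matrices, $E,A\in\mathbb R^{n\times n}$, $B\in\mathbb R^{n\times m}$, $C\in\mathbb R^{p\times n}$, $D\in\mathbb R^{p\times m}$, such that the pair $(E,A)$ is regular, i.e. $\rho(E,A):=\{s\in\mathbb C:\det(sE-A)\neq0\}\neq\emptyset$. Its transfer function is $G_S(s)=C(sE-A)^{-1}B+D$ for $s\in\rho(E,A)$. The system is stable if $\{\operatorname{Re}s\ge0\}\subseteq\rho(E,A)$, and antistable if $\{\operatorname{Re}s\le0\}\subseteq\rho(E,A)$ and $E$ is invertible. A system $T$ is a realization of $G_S$ if $G_T$ and $G_S$ agree on the intersection of their domains. The direct sum $S_1\oplus S_2$ is the system with block diagonal $E$ and $A$, with the $B_i$ stacked vertically, the $C_i$ side by side, and $D=D_1+D_2$. Two systems $S=(E,A,B,C,D)$ and $S'$ of the same dimensions are restricted system equivalent, $S\sim S'$, if $S'=(PEQ,PAQ,PB,CQ,D)$ for some invertible real matrices $P,Q$. Put $\|G\|_2:=\left(\frac1{2\pi}\int_{-\infty}^{\infty}\|G(i\omega)\|_F^2\,d\omega\right)^{1/2}\in[0,\infty]$,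 where $\|\cdot\|_F$ is the Frobenius norm. **Theorem.** Let $S=(E,A,B,C,D)$ be a system with $i\mathbb R\subseteq\rho(E,A)$. Then there exist a stable system $S_+$ and an antistable system $S_-$ with zero feedthrough matrix such that $S\sim S_+\oplus S_-$. For every such pair $(S_+,S_-)$, the system $S_+$ is an optimal $RH_2$-approximation of $S$; more precisely, $$\inf_{\widehat S}\|G_S-G_{\widehat S}\|_2=\|G_S-G_{S_+}\|_2=\|G_{S_-}\|_2<\infty,$$ where the infimum is over all stable systems $\widehat S$ of arbitrary state dimension with $m$ inputs and $p$ outputs. The optimum is unique in the following sense: every stable system $S_2$ with $\|G_S-G_{S_2}\|_2=\inf_{\widehat S}\|G_S-G_{\widehat S}\|_2$ is a realization of $G_{S_+}$. -/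

import Mathlib

open scoped ENNReal Matrix

/-- The coefficient matrices of a linear time-invariant descriptor system
`E x' = A x + B u`, `y = C x + D u` with state coordinates indexed by `ι`, with `p` outputs and
`m` inputs. Regularity of the pair `(E, A)` is the separate predicate
`DescriptorSystem.IsRegular`. -/
structure DescriptorSystem (ι : Type) (p m : ℕ) where
  E : Matrix ι ι ℝ
  A : Matrix ι ι ℝ
  B : Matrix ι (Fin m) ℝ
  C : Matrix (Fin p) ι ℝ
  D : Matrix (Fin p) (Fin m) ℝ

namespace DescriptorSystem

/-- The complex matrix `s E - A`. -/
def pencil {ι : Type} {p m : ℕ} (S : DescriptorSystem ι p m) (s : ℂ) : Matrix ι ι ℂ :=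
  s • S.E.map Complex.ofReal - S.A.map Complex.ofReal

/-- The resolvent set `ρ(E, A)`: the complex numbers that are not (finite) generalized eigenvalues
of `(E, A)`, i.e. those with `det (s E - A) ≠ 0`. -/
def resolventSet {ι : Type} [Fintype ι] [DecidableEq ι] {p m : ℕ}
    (S : DescriptorSystem ι p m) : Set ℂ :=
  {s | (S.pencil s).det ≠ 0}

/-- The matrix pair `(E, A)` is regular: its resolvent set is nonempty. -/
def IsRegular {ι : Type} [Fintype ι] [DecidableEq ι] {p m : ℕ}
    (S : DescriptorSystem ι p m) : Prop :=
  S.resolventSet.Nonempty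

/-- The system is regular and no generalized eigenvalue lies on the imaginary axis. -/
def HasNoImaginaryEigenvalue {ι : Type} [Fintype ι] [DecidableEq ι] {p m : ℕ}
    (S : DescriptorSystem ι p m) : Prop :=
  S.IsRegular ∧ {s : ℂ | s.re = 0} ⊆ S.resolventSet

/-- Stable systems: regular, with no generalized eigenvalue in the closed right half-plane.
The eigenvalue `∞` is allowed, i.e. `E` may be singular. -/
def IsStable {ι : Type} [Fintype ι] [DecidableEq ι] {p m : ℕ}
    (S : DescriptorSystem ι p m) : Prop :=
  S.IsRegular ∧ {s : ℂ | 0 ≤ s.re} ⊆ S.resolventSet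

/-- Antistable systems: regular, with no generalized eigenvalue in the closed left half-plane and
with `E` invertible. -/
def IsAntistable {ι : Type} [Fintype ι] [DecidableEq ι] {p m : ℕ}
    (S : DescriptorSystem ι p m) : Prop :=
  S.IsRegular ∧ {s : ℂ | s.re ≤ 0} ⊆ S.resolventSet ∧ IsUnit S.E

/-- The transfer function `s ↦ C (s E - A)⁻¹ B + D`. Its domain is `S.resolventSet`; the values
outside the domain carry no meaning. -/
noncomputable def transferFunction {ι : Type} [Fintype ι] [DecidableEq ι] {p m : ℕ}
    (S : DescriptorSystem ι p m) (s : ℂ) : Matrix (Fin p) (Fin m) ℂ :=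
  S.C.map Complex.ofReal * (S.pencil s)⁻¹ * S.B.map Complex.ofReal + S.D.map Complex.ofReal

/-- `T` is a realization of the transfer function of `S`: it is a (regular) system whose transfer
function agrees with that of `S` on the intersection of the two domains. -/
def IsRealizationOf {κ ι : Type} [Fintype κ] [DecidableEq κ] [Fintype ι] [DecidableEq ι]
    {p m : ℕ} (T : DescriptorSystem κ p m) (S : DescriptorSystem ι p m) : Prop :=
  T.IsRegular ∧
    ∀ s ∈ S.resolventSet ∩ T.resolventSet, S.transferFunction s = T.transferFunction s

/-- The direct sum `S₁ ⊕ S₂`. -/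
def directSum {ι κ : Type} {p m : ℕ} (S₁ : DescriptorSystem ι p m)
    (S₂ : DescriptorSystem κ p m) : DescriptorSystem (ι ⊕ κ) p m where
  E := Matrix.fromBlocks S₁.E 0 0 S₂.E
  A := Matrix.fromBlocks S₁.A 0 0 S₂.A
  B := Matrix.fromRows S₁.B S₂.B
  C := Matrix.fromCols S₁.C S₂.C
  D := S₁.D + S₂.D

/-- Renaming of the state coordinates along a bijection of the index types. -/
def reindex {ι κ : Type} {p m : ℕ} (e : ι ≃ κ) (S : DescriptorSystem ι p m) :
    DescriptorSystem κ p m where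
  E := S.E.submatrix e.symm e.symm
  A := S.A.submatrix e.symm e.symm
  B := S.B.submatrix e.symm id
  C := S.C.submatrix id e.symm
  D := S.D

/-- The transformed system `(P E Q, P A Q, P B, C Q, D)`. -/
def transform {ι : Type} [Fintype ι] {p m : ℕ} (P : Matrix ι ι ℝ)
    (S : DescriptorSystem ι p m) (Q : Matrix ι ι ℝ) : DescriptorSystem ι p m where
  E := P * S.E * Q
  A := P * S.A * Q
  B := P * S.B
  C := S.C * Q
  D := S.D

/-- Restricted system equivalence `S₁ ∼ S₂`: some real invertible `P`, `Q` transform `S₁` into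
`S₂`. The bijection only identifies index types of the same size, such as `Fin (a + b)` and
`Fin a ⊕ Fin b`. -/
def RestrictedSystemEquivalent {ι κ : Type} [Fintype κ] [DecidableEq κ] {p m : ℕ}
    (S₁ : DescriptorSystem ι p m) (S₂ : DescriptorSystem κ p m) : Prop :=
  ∃ (e : ι ≃ κ) (P Q : Matrix κ κ ℝ), IsUnit P ∧ IsUnit Q ∧ transform P (S₁.reindex e) Q = S₂

/-- `S ∼ S₊ ⊕ S₋` with `S₊` stable and `S₋` antistable with zero feedthrough matrix: `S₊` is a
stable part and `S₋` an antistable part of `S`. -/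
def IsStableAntistableDecomposition {ι κ₁ κ₂ : Type}
    [Fintype κ₁] [DecidableEq κ₁] [Fintype κ₂] [DecidableEq κ₂] {p m : ℕ}
    (S : DescriptorSystem ι p m) (Splus : DescriptorSystem κ₁ p m)
    (Sminus : DescriptorSystem κ₂ p m) : Prop :=
  Splus.IsStable ∧ Sminus.IsAntistable ∧ Sminus.D = 0 ∧
    S.RestrictedSystemEquivalent (Splus.directSum Sminus)

end DescriptorSystem

section L2Norm

attribute [local instance] Matrix.frobeniusNormedAddCommGroup

/-- `‖G‖₂ = ((1 / 2π) ∫ ‖G(iω)‖_F² dω)^(1/2)` with the Frobenius norm, as an extended nonnegative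
number; it is `∞` when the integral diverges. -/
noncomputable def l2Norm {p m : ℕ} (G : ℂ → Matrix (Fin p) (Fin m) ℂ) : ℝ≥0∞ :=
  (ENNReal.ofReal (1 / (2 * Real.pi)) *
    ∫⁻ ω : ℝ, ‖G (Complex.I * (ω : ℂ))‖ₑ ^ 2) ^ (1 / 2 : ℝ)

end L2Norm

namespace DescriptorSystem

/-- The infimum of `‖G_S - G_T‖₂` over the stable systems `T` of all state dimensions. -/
noncomputable def infStableL2Error {ι : Type} [Fintype ι] [DecidableEq ι] {p m : ℕ}
    (S : DescriptorSystem ι p m) : ℝ≥0∞ :=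
  ⨅ (k : ℕ) (T : DescriptorSystem (Fin k) p m) (_ : T.IsStable),
    l2Norm (S.transferFunction - T.transferFunction)

/-- `T` is an optimal `RH₂`-approximation of `S`: it is stable and attains the infimum of the
`L₂`-error over all stable systems. -/
def IsOptimalRH2Approximation {ι κ : Type} [Fintype ι] [DecidableEq ι] [Fintype κ]
    [DecidableEq κ] {p m : ℕ} (T : DescriptorSystem κ p m) (S : DescriptorSystem ι p m) : Prop :=
  T.IsStable ∧ l2Norm (S.transferFunction - T.transferFunction) = S.infStableL2Error

end DescriptorSystem

/-!
The generalized eigenvalues of `(E, A)` avoid `0`, so `A` is invertible and `S` is equivalent to a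
system with coefficient matrices `A⁻¹ E` and `1`, whose generalized eigenvalues are the inverses of
the nonzero eigenvalues of `A⁻¹ E`. The real characteristic polynomial of `A⁻¹ E` factors into a
part with roots in the open right half-plane and a coprime part with roots in the closed left
half-plane (`exists_factor_re_pos`), and the kernel decomposition (`exists_blockDiagonalization`)
gives the stable and the antistable summand
(`DescriptorSystem.exists_stableAntistableDecomposition`).

For any such decomposition `G_S = G₊ + G₋` on the imaginary axis, so the error of a stable
system `T` is `G₋ + (G₊ - G_T)`. Entry by entry, the first summand is rational without poles in the
closed left half-plane and is `O(1 / |s|)`, since `E₋` is invertible. The second is rational without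
poles in the closed right half-plane. If it is square integrable on the axis, it is strictly proper
(`IsRationalOn.decay`), and then the integrand of the inner product of the two summands extends
holomorphically to the right half-plane with decay `O(1 / |s|²)`, so that the inner product vanishes
by Cauchy's theorem (`integral_axis_eq_zero`, `integral_conj_mul_eq_zero`). Hence
`‖G_S - G_T‖₂² = ‖G₋‖₂² + ‖G₊ - G_T‖₂²`, with both sides infinite when `G₊ - G_T` is not square
integrable (`lintegral_sq_add`, `DescriptorSystem.axisEnergy_error`). Since `‖G₋‖₂` is finite, the
error is minimal exactly when `‖G₊ - G_T‖₂ = 0`. In that case `G₊ - G_T` vanishes on the axis, and,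
being rational, wherever both transfer functions are defined.
-/

/-! ### Rational functions on the imaginary axis -/

section RationalFunctions

open Polynomial Filter Asymptotics MeasureTheory Topology Bornology

/-- `f` agrees on `U` with a quotient of two complex polynomials whose denominator has no zero
in `U`; nothing is asked of `f` outside `U`. -/
def IsRationalOn (f : ℂ → ℂ) (U : Set ℂ) : Prop :=
  ∃ N D : ℂ[X], ∀ s ∈ U, D.eval s ≠ 0 ∧ f s = N.eval s / D.eval s

namespace IsRationalOn

variable {f g : ℂ → ℂ} {U V : Set ℂ}

theorem mono (hf : IsRationalOn f U) (hVU : V ⊆ U) : IsRationalOn f V := by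
  obtain ⟨N, D, h⟩ := hf
  exact ⟨N, D, fun s hs => h s (hVU hs)⟩

theorem sub (hf : IsRationalOn f U) (hg : IsRationalOn g U) :
    IsRationalOn (fun s => f s - g s) U := by
  obtain ⟨N, D, h⟩ := hf
  obtain ⟨N', D', h'⟩ := hg
  refine ⟨N * D' - D * N', D * D', fun s hs => ?_⟩
  obtain ⟨h1, h2⟩ := h s hs
  obtain ⟨h3, h4⟩ := h' s hs
  refine ⟨by simp [h1, h3], ?_⟩
  simp only [h2, h4, eval_sub, eval_mul, div_sub_div _ _ h1 h3]

theorem differentiableOn (hf : IsRationalOn f U) : DifferentiableOn ℂ f U := by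
  obtain ⟨N, D, h⟩ := hf
  exact (N.differentiable.differentiableOn.div D.differentiable.differentiableOn
    fun s hs => (h s hs).1).congr fun s hs => (h s hs).2

theorem continuous_axis (hf : IsRationalOn f U) (hU : {s : ℂ | s.re = 0} ⊆ U) :
    Continuous fun ω : ℝ => f (Complex.I * ω) :=
  (hf.mono hU).differentiableOn.continuousOn.comp_continuous (by fun_prop) fun ω => by simp

/-- A rational function that vanishes on the imaginary axis vanishes identically, because its
numerator has infinitely many zeros. -/
theorem eq_zero_of_axis (hf : IsRationalOn f U) (hU : {s : ℂ | s.re = 0} ⊆ U)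
    (h0 : ∀ ω : ℝ, f (Complex.I * ω) = 0) : ∀ s ∈ U, f s = 0 := by
  obtain ⟨N, D, h⟩ := hf
  have hN : N = 0 := by
    refine N.eq_zero_of_infinite_isRoot ?_
    have hinj : Function.Injective fun ω : ℝ => Complex.I * (ω : ℂ) := fun a b hab => by
      simpa using hab
    refine (Set.infinite_range_of_injective hinj).mono ?_
    rintro _ ⟨ω, rfl⟩
    obtain ⟨h1, h2⟩ := h (Complex.I * ω) (hU (by simp))
    rw [h0, eq_comm, div_eq_zero_iff] at h2
    exact h2.resolve_right h1
  intro s hs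
  simp [(h s hs).2, hN]

end IsRationalOn

theorem tendsto_I_mul_cobounded :
    Tendsto (fun ω : ℝ => Complex.I * (ω : ℂ)) atTop (cobounded ℂ) := by
  rw [← tendsto_norm_atTop_iff_cobounded]
  simpa using tendsto_abs_atTop_atTop

/-- A rational function that is square integrable on the imaginary axis is strictly proper: a
rational function that does not decay is bounded away from zero near infinity. -/
theorem IsRationalOn.decay {f : ℂ → ℂ} {U : Set ℂ} (hf : IsRationalOn f U)
    (hU : {s : ℂ | s.re = 0} ⊆ U) (hfin : ∫⁻ ω : ℝ, ‖f (Complex.I * ω)‖ₑ ^ 2 ≠ ∞) :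
    ∃ c R : ℝ, ∀ s ∈ U, R ≤ ‖s‖ → ‖f s‖ * ‖s‖ ≤ c := by
  obtain ⟨N, D, h⟩ := hf
  have hdeg : N.degree < D.degree := by
    by_contra! hle
    -- `D = O(N)` bounds `‖f‖` below by `c⁻¹` on a half-line of the axis, which has infinite measure
    obtain ⟨c, hc, hb⟩ := (isBigO_cobounded_of_degree_le hle).exists_pos
    have hev := tendsto_I_mul_cobounded.eventually hb.bound
    obtain ⟨a, ha⟩ := eventually_atTop.1 hev
    have hlow : ∀ ω ∈ Set.Ici a, ENNReal.ofReal c⁻¹ ^ 2 ≤ ‖f (Complex.I * ω)‖ₑ ^ 2 := by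
      intro ω hω
      obtain ⟨h1, h2⟩ := h (Complex.I * ω) (hU (by simp))
      gcongr
      rw [← ofReal_norm]
      apply ENNReal.ofReal_le_ofReal
      rw [h2, norm_div, le_div_iff₀ (norm_pos_iff.2 h1), inv_mul_le_iff₀ hc]
      exact ha ω hω
    refine hfin (top_le_iff.1 ?_)
    calc (∞ : ℝ≥0∞) = ∫⁻ _ω in Set.Ici a, ENNReal.ofReal c⁻¹ ^ 2 := by
          rw [setLIntegral_const, Real.volume_Ici, ENNReal.mul_top]
          simpa using hc
      _ ≤ ∫⁻ ω in Set.Ici a, ‖f (Complex.I * ω)‖ₑ ^ 2 :=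
          setLIntegral_mono' measurableSet_Ici hlow
      _ ≤ _ := setLIntegral_le_lintegral _ _
  -- strict properness of `N / D` makes `s * N(s) = O(D(s))`
  have hdeg' : (N * X).degree ≤ D.degree := by
    rcases eq_or_ne N 0 with rfl | hN
    · simp
    · have hD : D ≠ 0 := by rintro rfl; simp at hdeg
      rw [degree_mul_X, degree_eq_natDegree hN, degree_eq_natDegree hD] at *
      exact_mod_cast hdeg
  obtain ⟨c, hb⟩ := (isBigO_cobounded_of_degree_le hdeg').bound
  rw [← comap_norm_atTop, eventually_comap] at hb
  obtain ⟨R, hR⟩ := eventually_atTop.1 hb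
  refine ⟨c, R, fun s hs hRs => ?_⟩
  obtain ⟨h1, h2⟩ := h s hs
  have := hR _ hRs s rfl
  rw [eval_mul, eval_X, norm_mul] at this
  rw [h2, norm_div, div_mul_eq_mul_div, div_le_iff₀ (norm_pos_iff.2 h1)]
  exact this

/-- A continuous function on the line which is `O(1 / |ω|)` at infinity is square integrable. -/
theorem lintegral_sq_ne_top_of_decay {u : ℝ → ℂ} (hu : Continuous u) {c R : ℝ}
    (hb : ∀ ω : ℝ, R ≤ |ω| → ‖u ω‖ * |ω| ≤ c) : ∫⁻ ω : ℝ, ‖u ω‖ₑ ^ 2 ≠ ∞ := by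
  obtain ⟨b, hbd⟩ := (isCompact_Icc (a := -R) (b := R)).exists_bound_of_continuousOn
    hu.continuousOn
  obtain ⟨b₁, hbd₁⟩ := (isCompact_Icc (a := (-1 : ℝ)) (b := 1)).exists_bound_of_continuousOn
    hu.continuousOn
  set K : ℝ := max 0 (max (b ^ 2 * (1 + R ^ 2)) (max (b₁ ^ 2 * 2) (2 * c ^ 2)))
  have key : ∀ ω : ℝ, ‖u ω‖ ^ 2 ≤ K * (1 + ω ^ 2)⁻¹ := by
    intro ω
    rw [← div_eq_mul_inv, le_div_iff₀ (by positivity)]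
    rcases le_total |ω| R with h | h
    · have h1 := hbd ω (abs_le.1 h)
      have h2 : ω ^ 2 ≤ R ^ 2 := sq_le_sq' (by linarith [(abs_le.1 h).1]) (abs_le.1 h).2
      calc ‖u ω‖ ^ 2 * (1 + ω ^ 2) ≤ b ^ 2 * (1 + R ^ 2) := by gcongr
        _ ≤ K := by simp [K]
    · rcases le_total |ω| 1 with h' | h'
      · have h1 := hbd₁ ω (abs_le.1 h')
        have h2 : ω ^ 2 ≤ 1 := by rw [← sq_abs]; exact pow_le_one₀ (abs_nonneg _) h'
        calc ‖u ω‖ ^ 2 * (1 + ω ^ 2) ≤ b₁ ^ 2 * 2 := by gcongr; linarith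
          _ ≤ K := by simp [K]
      · have h2 : 1 ≤ ω ^ 2 := by rw [← sq_abs]; exact one_le_pow₀ h'
        calc ‖u ω‖ ^ 2 * (1 + ω ^ 2) ≤ ‖u ω‖ ^ 2 * (2 * ω ^ 2) := by gcongr; linarith
          _ = 2 * (‖u ω‖ * |ω|) ^ 2 := by rw [mul_pow, sq_abs]; ring
          _ ≤ 2 * c ^ 2 := by gcongr; exact hb ω h
          _ ≤ K := by simp [K]
  have hint : Integrable fun ω : ℝ => K * (1 + ω ^ 2)⁻¹ := integrable_inv_one_add_sq.const_mul K
  refine ((lintegral_mono fun ω => ?_).trans_lt hint.lintegral_lt_top).ne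
  rw [← ofReal_norm, ← ENNReal.ofReal_pow (norm_nonneg _)]
  exact ENNReal.ofReal_le_ofReal (key ω)

/-- **Cauchy's theorem in the right half-plane.** A function that is holomorphic on the closed
right half-plane and `O(1 / |s|²)` at infinity has integral zero along the imaginary axis. -/
theorem integral_axis_eq_zero {f : ℂ → ℂ} (hf : DifferentiableOn ℂ f {s | 0 ≤ s.re}) {c R₀ : ℝ}
    (hb : ∀ s : ℂ, 0 ≤ s.re → R₀ ≤ ‖s‖ → ‖f s‖ * ‖s‖ ^ 2 ≤ c)
    (hint : Integrable fun ω : ℝ => f (Complex.I * ω)) : ∫ ω : ℝ, f (Complex.I * ω) = 0 := by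
  have hlim := intervalIntegral_tendsto_integral hint tendsto_neg_atTop_atBot tendsto_id
  refine tendsto_nhds_unique hlim ?_
  have hbound : ∀ᶠ R : ℝ in atTop, ‖∫ ω in -R..R, f (Complex.I * ω)‖ ≤ 4 * c * R⁻¹ := by
    filter_upwards [eventually_ge_atTop R₀, eventually_gt_atTop 0] with R hR hR0
    have hfar : ∀ s : ℂ, 0 ≤ s.re → R ≤ ‖s‖ → ‖f s‖ ≤ c / R ^ 2 := by
      intro s hs hRs
      rw [le_div_iff₀ (by positivity)]
      calc ‖f s‖ * R ^ 2 ≤ ‖f s‖ * ‖s‖ ^ 2 := by gcongr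
        _ ≤ c := hb s hs (hR.trans hRs)
    -- the rectangle `[0, R] × [-R, R]`: on its sides off the axis `‖f‖ ≤ c / R ^ 2`
    have hrect := Complex.integral_boundary_rect_eq_zero_of_differentiableOn f
      (-(R : ℂ) * Complex.I) (R + R * Complex.I) (hf.mono fun s hs => by
        have := hs.1
        simp only [Set.mem_preimage] at this
        simp only [neg_mul, Complex.neg_re, Complex.mul_re, Complex.ofReal_re, Complex.I_re,
          mul_zero, Complex.ofReal_im, Complex.I_im, mul_one, sub_self, neg_zero,
          Complex.add_re, add_zero, Set.uIcc_of_le hR0.le] at this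
        exact this.1)
    simp only [neg_mul, Complex.neg_re, Complex.mul_re, Complex.ofReal_re, Complex.I_re,
      mul_zero, Complex.ofReal_im, Complex.I_im, mul_one, sub_self, neg_zero, Complex.add_re,
      add_zero, Complex.neg_im, Complex.mul_im, zero_add, Complex.add_im, Complex.ofReal_neg,
      Complex.ofReal_zero, smul_eq_mul] at hrect
    have h1 : ‖∫ x : ℝ in (0 : ℝ)..R, f (x + -(R * Complex.I))‖ ≤ c / R ^ 2 * |R - 0| :=
      intervalIntegral.norm_integral_le_of_norm_le_const fun x hx => by
        rw [Set.uIoc_of_le hR0.le] at hx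
        refine hfar _ (by simpa using hx.1.le) ?_
        have := Complex.abs_im_le_norm (x + -(R * Complex.I))
        simp [abs_of_pos hR0] at this
        exact this
    have h2 : ‖∫ x : ℝ in (0 : ℝ)..R, f (x + R * Complex.I)‖ ≤ c / R ^ 2 * |R - 0| :=
      intervalIntegral.norm_integral_le_of_norm_le_const fun x hx => by
        rw [Set.uIoc_of_le hR0.le] at hx
        refine hfar _ (by simpa using hx.1.le) ?_
        have := Complex.abs_im_le_norm (x + R * Complex.I)
        simp [abs_of_pos hR0] at this
        exact this
    have h3 : ‖∫ y : ℝ in -R..R, f (R + y * Complex.I)‖ ≤ c / R ^ 2 * |R - -R| :=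
      intervalIntegral.norm_integral_le_of_norm_le_const fun y _ => by
        refine hfar _ (by simpa using hR0.le) ?_
        have := Complex.abs_re_le_norm (R + y * Complex.I)
        simp [abs_of_pos hR0] at this
        exact this
    have heq : (∫ ω : ℝ in -R..R, f (Complex.I * ω)) =
        -Complex.I * (∫ x : ℝ in (0 : ℝ)..R, f (x + -(R * Complex.I)))
          + Complex.I * (∫ x : ℝ in (0 : ℝ)..R, f (x + R * Complex.I))
          + ∫ y : ℝ in -R..R, f (R + y * Complex.I) := by
      have hswap : (∫ ω : ℝ in -R..R, f (Complex.I * ω)) = ∫ y : ℝ in -R..R, f (y * Complex.I) := by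
        simp_rw [mul_comm]
      rw [hswap]
      linear_combination (Complex.I) * hrect + ((∫ y : ℝ in -R..R, f (y * Complex.I))
        - ∫ y : ℝ in -R..R, f (R + y * Complex.I)) * Complex.I_sq
    rw [heq]
    refine (norm_add₃_le).trans ?_
    rw [norm_mul, norm_mul, norm_neg, Complex.norm_I, one_mul, one_mul]
    rw [sub_zero, abs_of_pos hR0] at h1 h2
    rw [sub_neg_eq_add, abs_of_pos (by linarith)] at h3
    calc _ ≤ c / R ^ 2 * R + c / R ^ 2 * R + c / R ^ 2 * (R + R) := by gcongr
      _ = 4 * c * R⁻¹ := by field_simp; ring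
  refine squeeze_zero_norm' hbound ?_
  simpa using tendsto_inv_atTop_zero.const_mul (4 * c)

end RationalFunctions

/-! ### Orthogonality of the two half-planes -/

section Orthogonality

open Polynomial MeasureTheory
open scoped ComplexConjugate

/-- Reflecting the argument in the imaginary axis and conjugating the value turns a rational
function on the left half-plane into one on the right half-plane. -/
theorem IsRationalOn.reflect {g : ℂ → ℂ} (hg : IsRationalOn g {s | s.re ≤ 0}) :
    IsRationalOn (fun s => conj (g (-conj s))) {s | 0 ≤ s.re} := by
  obtain ⟨N, D, h⟩ := hg
  have key : ∀ (P : ℂ[X]) (s : ℂ),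
      ((P.map (starRingEnd ℂ)).comp (-X)).eval s = conj (P.eval (-conj s)) := by
    intro P s
    rw [eval_comp, eval_neg, eval_X, ← Polynomial.eval_map_apply]
    simp
  refine ⟨(N.map (starRingEnd ℂ)).comp (-X), (D.map (starRingEnd ℂ)).comp (-X), fun s hs => ?_⟩
  obtain ⟨h1, h2⟩ := h (-conj s) (by simpa using hs)
  rw [key, key]
  exact ⟨by simpa using h1, by simp only [h2, map_div₀]⟩

theorem integrable_sq_norm_of_lintegral {u : ℝ → ℂ} (hu : Continuous u)
    (hfin : ∫⁻ ω, ‖u ω‖ₑ ^ 2 ≠ ∞) : Integrable fun ω => ‖u ω‖ ^ 2 := by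
  refine ⟨by fun_prop, ?_⟩
  rw [hasFiniteIntegral_iff_enorm]
  simpa [enorm_pow] using hfin.lt_top

theorem lintegral_sq_eq_ofReal {u : ℝ → ℂ} (hu : Integrable fun ω => ‖u ω‖ ^ 2) :
    ∫⁻ ω, ‖u ω‖ₑ ^ 2 = ENNReal.ofReal (∫ ω, ‖u ω‖ ^ 2) := by
  rw [ofReal_integral_eq_lintegral_ofReal hu (.of_forall fun _ => by positivity)]
  refine lintegral_congr fun ω => ?_
  rw [ENNReal.ofReal_pow (norm_nonneg _), ofReal_norm]

/-- Rational functions in `L²(iℝ)` with poles only in the open right, respectively left, half-plane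
are orthogonal: the integrand of their inner product extends to the right half-plane as
`s ↦ conj (g (-conj s)) * h s`, which is holomorphic there and `O(1 / |s|²)`. -/
theorem integral_conj_mul_eq_zero {g h : ℂ → ℂ} (hg : IsRationalOn g {s | s.re ≤ 0})
    (hh : IsRationalOn h {s | 0 ≤ s.re})
    (hgfin : ∫⁻ ω : ℝ, ‖g (Complex.I * ω)‖ₑ ^ 2 ≠ ∞)
    (hhfin : ∫⁻ ω : ℝ, ‖h (Complex.I * ω)‖ₑ ^ 2 ≠ ∞) :
    Integrable (fun ω : ℝ => conj (g (Complex.I * ω)) * h (Complex.I * ω)) ∧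
      ∫ ω : ℝ, conj (g (Complex.I * ω)) * h (Complex.I * ω) = 0 := by
  have hUg : {s : ℂ | s.re = 0} ⊆ {s | s.re ≤ 0} := fun s hs => le_of_eq hs
  have hUh : {s : ℂ | s.re = 0} ⊆ {s | 0 ≤ s.re} := fun s hs => ge_of_eq hs
  have cg := hg.continuous_axis hUg
  have ch := hh.continuous_axis hUh
  have hint : Integrable fun ω : ℝ => conj (g (Complex.I * ω)) * h (Complex.I * ω) := by
    refine ((integrable_sq_norm_of_lintegral cg hgfin).add
      (integrable_sq_norm_of_lintegral ch hhfin)).mono'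
      ((Complex.continuous_conj.comp cg).mul ch).aestronglyMeasurable (.of_forall fun ω => ?_)
    rw [norm_mul, RCLike.norm_conj]
    simp only [Pi.add_apply]
    nlinarith [sq_nonneg (‖g (Complex.I * ω)‖ - ‖h (Complex.I * ω)‖),
      sq_nonneg (‖g (Complex.I * ω)‖ + ‖h (Complex.I * ω)‖)]
  refine ⟨hint, ?_⟩
  obtain ⟨c, R, hdg⟩ := hg.decay hUg hgfin
  obtain ⟨c', R', hdh⟩ := hh.decay hUh hhfin
  have haxis : ∀ ω : ℝ, -conj (Complex.I * (ω : ℂ)) = Complex.I * ω := fun ω => by simp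
  have hcauchy := integral_axis_eq_zero (f := fun s => conj (g (-conj s)) * h s)
    (c := c * c') (R₀ := max R R')
    (hg.reflect.differentiableOn.mul hh.differentiableOn)
    (fun s hs hR => by
      have h1 := hdg (-conj s) (by simpa using hs) (by simpa using (le_max_left _ _).trans hR)
      have h2 := hdh s hs ((le_max_right _ _).trans hR)
      rw [norm_neg, RCLike.norm_conj] at h1
      rw [norm_mul, RCLike.norm_conj]
      calc ‖g (-conj s)‖ * ‖h s‖ * ‖s‖ ^ 2 = (‖g (-conj s)‖ * ‖s‖) * (‖h s‖ * ‖s‖) := by ring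
        _ ≤ c * c' := mul_le_mul h1 h2 (by positivity) ((by positivity : (0 : ℝ) ≤ _).trans h1))
    (by simpa only [haxis] using hint)
  simpa only [haxis] using hcauchy

/-- The Pythagorean theorem for a square integrable rational `g` with poles in the open right
half-plane and any rational `h` with poles in the open left half-plane; both sides are `∞` when `h`
is not square integrable. -/
theorem lintegral_sq_add {g h : ℂ → ℂ} (hg : IsRationalOn g {s | s.re ≤ 0})
    (hh : IsRationalOn h {s | 0 ≤ s.re})
    (hgfin : ∫⁻ ω : ℝ, ‖g (Complex.I * ω)‖ₑ ^ 2 ≠ ∞) :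
    ∫⁻ ω : ℝ, ‖g (Complex.I * ω) + h (Complex.I * ω)‖ₑ ^ 2 =
      (∫⁻ ω : ℝ, ‖g (Complex.I * ω)‖ₑ ^ 2) + ∫⁻ ω : ℝ, ‖h (Complex.I * ω)‖ₑ ^ 2 := by
  have cg := hg.continuous_axis fun s hs => le_of_eq hs
  have ch := hh.continuous_axis fun s hs => ge_of_eq hs
  have hIg := integrable_sq_norm_of_lintegral cg hgfin
  by_cases hhfin : ∫⁻ ω : ℝ, ‖h (Complex.I * ω)‖ₑ ^ 2 = ∞
  -- if `g + h` were square integrable, so would be `h = (g + h) - g`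
  · rw [hhfin, add_top]
    by_contra hsum
    have hIs := integrable_sq_norm_of_lintegral (cg.add ch) hsum
    have hIh : Integrable fun ω : ℝ => ‖h (Complex.I * ω)‖ ^ 2 := by
      refine ((hIs.add hIg).const_mul 2).mono' (ch.norm.pow 2).aestronglyMeasurable
        (.of_forall fun ω => ?_)
      simp only [Pi.add_apply, norm_pow, norm_norm]
      have := norm_sub_le (g (Complex.I * ω) + h (Complex.I * ω)) (g (Complex.I * ω))
      rw [add_sub_cancel_left] at this
      have h2 := pow_le_pow_left₀ (norm_nonneg _) this 2
      nlinarith [sq_nonneg (‖g (Complex.I * ω) + h (Complex.I * ω)‖ - ‖g (Complex.I * ω)‖)]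
    rw [lintegral_sq_eq_ofReal hIh] at hhfin
    exact ENNReal.ofReal_ne_top hhfin
  · have hIh := integrable_sq_norm_of_lintegral ch hhfin
    obtain ⟨hI, h0⟩ := integral_conj_mul_eq_zero hg hh hgfin hhfin
    have hpt : ∀ ω : ℝ, ‖g (Complex.I * ω) + h (Complex.I * ω)‖ ^ 2 =
        ‖g (Complex.I * ω)‖ ^ 2 + ‖h (Complex.I * ω)‖ ^ 2 +
          2 * (conj (g (Complex.I * ω)) * h (Complex.I * ω)).re := by
      intro ω
      simp only [← Complex.normSq_eq_norm_sq, Complex.normSq_apply, Complex.add_re, Complex.add_im,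
        Complex.mul_re, Complex.conj_re, Complex.conj_im]
      ring
    have hIre := hI.re.const_mul 2
    have hre : ∫ ω : ℝ, (conj (g (Complex.I * ω)) * h (Complex.I * ω)).re = 0 := by
      have := integral_re hI
      simp only [RCLike.re_eq_complex_re] at this
      rw [this, h0, Complex.zero_re]
    simp only [RCLike.re_eq_complex_re] at hIre
    have hIs : Integrable fun ω : ℝ => ‖g (Complex.I * ω) + h (Complex.I * ω)‖ ^ 2 := by
      simp_rw [hpt]
      exact (hIg.add hIh).add hIre
    rw [lintegral_sq_eq_ofReal hIg, lintegral_sq_eq_ofReal hIh, lintegral_sq_eq_ofReal hIs,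
      ← ENNReal.ofReal_add (integral_nonneg fun _ => by positivity)
        (integral_nonneg fun _ => by positivity)]
    simp_rw [hpt]
    have hIgh : Integrable fun ω : ℝ => ‖g (Complex.I * ω)‖ ^ 2 + ‖h (Complex.I * ω)‖ ^ 2 :=
      hIg.add hIh
    rw [integral_add hIgh hIre, integral_add hIg hIh, integral_const_mul, hre, mul_zero,
      add_zero]

end Orthogonality

/-! ### Splitting a real matrix by the real parts of its eigenvalues -/

section PolynomialSplitting

open Polynomial

/-- A nonzero real polynomial splits over the reals according to the sign of the real parts of its
complex roots, because conjugate roots have the same real part. -/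
theorem exists_factor_re_pos (f : ℝ[X]) (hf : f ≠ 0) :
    ∃ p q : ℝ[X], f = p * q ∧ (∀ z : ℂ, aeval z p = 0 → 0 < z.re) ∧
      ∀ z : ℂ, aeval z q = 0 → z.re ≤ 0 := by
  induction hn : f.natDegree using Nat.strong_induction_on generalizing f with
  | _ n ih =>
    by_cases hroot : ∀ z : ℂ, aeval z f = 0 → z.re ≤ 0
    · exact ⟨1, f, by simp, by simp, hroot⟩
    · push Not at hroot
      obtain ⟨z, hz, hzpos⟩ := hroot
      -- `d` is the real minimal polynomial of `z`, of degree one or two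
      obtain ⟨d, hd1, hdf, hdroot⟩ : ∃ d : ℝ[X], 1 ≤ d.natDegree ∧ d ∣ f ∧
          ∀ w : ℂ, aeval w d = 0 → 0 < w.re := by
        by_cases him : z.im = 0
        · have hzr : z = (z.re : ℂ) := Complex.ext (by simp) (by simpa using him)
          refine ⟨X - C z.re, by simp, ?_, fun w hw => ?_⟩
          · rw [dvd_iff_isRoot, IsRoot]
            rw [hzr, ← Complex.coe_algebraMap, aeval_algebraMap_apply] at hz
            simpa using hz
          · rw [aeval_sub, aeval_X, aeval_C, sub_eq_zero] at hw
            simpa [hw] using hzpos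
        · refine ⟨_, ?_, quadratic_dvd_of_aeval_eq_zero_im_ne_zero f hz him, fun w hw => ?_⟩
          · rw [show X ^ 2 - C (2 * z.re) * X + C (‖z‖ ^ 2) =
              C 1 * X ^ 2 + C (-(2 * z.re)) * X + C (‖z‖ ^ 2) by simp; ring]
            rw [natDegree_quadratic one_ne_zero]; norm_num
          · have h2 : (w - z) * (w - (starRingEnd ℂ) z) = 0 := by
              rw [← hw]
              simp only [map_add, map_sub, map_mul, map_pow, aeval_X, aeval_C,
                Complex.coe_algebraMap, Complex.ofReal_ofNat]
              rw [← Complex.mul_conj', Complex.re_eq_add_conj]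
              ring
            rcases mul_eq_zero.1 h2 with h3 | h3
            · rwa [sub_eq_zero.1 h3]
            · rw [sub_eq_zero.1 h3]; simpa using hzpos
      obtain ⟨f', rfl⟩ := hdf
      have hd0 : d ≠ 0 := left_ne_zero_of_mul hf
      have hf0 : f' ≠ 0 := right_ne_zero_of_mul hf
      rw [natDegree_mul hd0 hf0] at hn
      obtain ⟨p, q, rfl, hp, hq⟩ := ih f'.natDegree (by omega) f' hf0 rfl
      refine ⟨d * p, q, by ring, fun w hw => ?_, hq⟩
      rw [aeval_mul] at hw
      exact (mul_eq_zero.1 hw).elim (hdroot w) (hp w)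

end PolynomialSplitting

section SpectralSplitting

open Polynomial Module

/-- Let `p` annihilate the real matrix `N`. If `s N - 1` is singular then `s⁻¹` is an eigenvalue of
`N`, hence a root of `p`. -/
theorem aeval_inv_eq_zero_of_det_eq_zero {k : ℕ} {N : Matrix (Fin k) (Fin k) ℝ} {p : ℝ[X]}
    (hp : aeval N p = 0) {s : ℂ}
    (hs : (s • N.map Complex.ofReal - (1 : Matrix (Fin k) (Fin k) ℝ).map Complex.ofReal).det = 0) :
    s ≠ 0 ∧ aeval s⁻¹ p = 0 := by
  obtain ⟨v, hv, hv0⟩ := Matrix.exists_mulVec_eq_zero_iff.2 hs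
  have hone : (1 : Matrix (Fin k) (Fin k) ℝ).map Complex.ofReal = 1 :=
    Matrix.map_one _ Complex.ofReal_zero Complex.ofReal_one
  rw [hone, Matrix.sub_mulVec, Matrix.one_mulVec, sub_eq_zero, Matrix.smul_mulVec] at hv0
  have hs0 : s ≠ 0 := by
    rintro rfl
    exact hv (by rw [← hv0, zero_smul])
  refine ⟨hs0, ?_⟩
  have hev : Module.End.HasEigenvector (Matrix.toLin' (N.map Complex.ofReal)) s⁻¹ v := by
    refine ⟨Module.End.mem_eigenspace_iff.2 ?_, hv⟩
    rw [Matrix.toLin'_apply, eq_inv_smul_iff₀ hs0, hv0]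
  have h1 := Module.End.aeval_apply_of_hasEigenvector (p := p.map (algebraMap ℝ ℂ)) hev
  have h2 : aeval (Matrix.toLin' (N.map Complex.ofReal)) (p.map (algebraMap ℝ ℂ)) = 0 := by
    have h3 : aeval (Complex.ofRealAm.mapMatrix N) p = Complex.ofRealAm.mapMatrix (aeval N p) :=
      aeval_algHom_apply _ _ _
    rw [hp, map_zero] at h3
    rw [aeval_map_algebraMap]
    have h4 := aeval_algHom_apply
      ((Matrix.toLinAlgEquiv' (R := ℂ) (n := Fin k)).toAlgHom.restrictScalars ℝ) (N.map Complex.ofReal) p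
    refine Eq.trans h4 ?_
    have h5 : aeval (N.map Complex.ofReal) p = 0 := h3
    rw [h5, map_zero]
  rw [h2, LinearMap.zero_apply, eq_comm, smul_eq_zero] at h1
  simpa using h1.resolve_right hv

end SpectralSplitting

section BlockDiagonalization

open Polynomial Module

theorem aeval_restrict_apply {V : Type*} [AddCommGroup V] [Module ℝ V] (φ : End ℝ V)
    {W : Submodule ℝ V} (hW : ∀ x ∈ W, φ x ∈ W) (r : ℝ[X]) (x : W) :
    ((aeval (φ.restrict hW) r x : W) : V) = aeval φ r (x : V) := by
  induction r using Polynomial.induction_on' with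
  | add r s hr hs => simp [hr, hs]
  | monomial k c =>
    rw [aeval_monomial, aeval_monomial, Module.End.mul_apply, Module.End.mul_apply,
      Module.End.pow_restrict]
    simp

/-- Kernel decomposition in matrix form. The columns of `Q` are bases of the kernels of `q(M)` and
`p(M)`. -/
theorem exists_blockDiagonalization {n : ℕ} (M : Matrix (Fin n) (Fin n) ℝ) {p q : ℝ[X]}
    (hpq : IsCoprime p q) (hM : aeval M (p * q) = 0) :
    ∃ (a b : ℕ) (e : Fin n ≃ Fin a ⊕ Fin b) (P Q : Matrix (Fin a ⊕ Fin b) (Fin a ⊕ Fin b) ℝ)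
      (N₁ : Matrix (Fin a) (Fin a) ℝ) (N₂ : Matrix (Fin b) (Fin b) ℝ),
      P * Q = 1 ∧ P * M.submatrix e.symm e.symm * Q = Matrix.fromBlocks N₁ 0 0 N₂ ∧
        aeval N₁ q = 0 ∧ aeval N₂ p = 0 := by
  classical
  set φ : End ℝ (Fin n → ℝ) := Matrix.toLin' M with hφ
  have hφ0 : aeval φ (p * q) = 0 := by
    have h := aeval_algHom_apply (Matrix.toLinAlgEquiv' (R := ℝ) (n := Fin n)).toAlgHom M (p * q)
    rw [hM, map_zero] at h
    exact h
  set K₁ := LinearMap.ker (aeval φ q)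
  set K₂ := LinearMap.ker (aeval φ p)
  have hcompl : IsCompl K₁ K₂ := by
    refine ⟨disjoint_ker_aeval_of_isCoprime φ hpq.symm, codisjoint_iff.2 ?_⟩
    rw [sup_ker_aeval_eq_ker_aeval_mul_of_coprime φ hpq.symm, mul_comm, hφ0, LinearMap.ker_zero]
  have hinv : ∀ r : ℝ[X], ∀ x ∈ LinearMap.ker (aeval φ r), φ x ∈ LinearMap.ker (aeval φ r) := by
    intro r x hx
    rw [LinearMap.mem_ker] at hx ⊢
    have h : aeval φ r * φ = φ * aeval φ r := by
      have := congrArg (aeval φ) (mul_comm r X)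
      simpa using this
    rw [← Module.End.mul_apply, h, Module.End.mul_apply, hx, map_zero]
  set φ₁ : End ℝ K₁ := φ.restrict (hinv q)
  set φ₂ : End ℝ K₂ := φ.restrict (hinv p)
  set b₁ := finBasis ℝ K₁
  set b₂ := finBasis ℝ K₂
  set f := Submodule.prodEquivOfIsCompl K₁ K₂ hcompl
  -- the basis of the whole space adapted to the two kernels
  set b := (b₁.prod b₂).map f
  set e := (Pi.basisFun ℝ (Fin n)).indexEquiv b
  set c := (Pi.basisFun ℝ (Fin n)).reindex e
  have hφc : LinearMap.toMatrix c c φ = M.submatrix e.symm e.symm := by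
    ext i j
    simp [c, hφ, LinearMap.toMatrix_apply, Pi.basisFun_repr]
  have hφb : LinearMap.toMatrix b b φ =
      Matrix.fromBlocks (LinearMap.toMatrix b₁ b₁ φ₁) 0 0 (LinearMap.toMatrix b₂ b₂ φ₂) := by
    rw [← LinearMap.toMatrix_prodMap]
    ext i j
    have hcomm : ∀ x, φ (f x) = f (φ₁.prodMap φ₂ x) := by
      intro x
      simp [f, φ₁, φ₂]
    rw [LinearMap.toMatrix_apply, LinearMap.toMatrix_apply, Basis.map_apply, hcomm, Basis.map_repr,
      LinearEquiv.trans_apply, LinearEquiv.symm_apply_apply]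
  have hann : ∀ (r : ℝ[X]), aeval (φ.restrict (hinv r)) r = 0 := by
    intro r
    ext x
    rw [aeval_restrict_apply]
    simp
  refine ⟨_, _, e, b.toMatrix c, c.toMatrix b, LinearMap.toMatrix b₁ b₁ φ₁,
    LinearMap.toMatrix b₂ b₂ φ₂, b.toMatrix_mul_toMatrix_flip c, ?_, ?_, ?_⟩
  · rw [← hφc, basis_toMatrix_mul_linearMap_toMatrix_mul_basis_toMatrix, hφb]
  · have h := aeval_algHom_apply (LinearMap.toMatrixAlgEquiv b₁).toAlgHom φ₁ q
    rw [hann q, map_zero] at h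
    exact h
  · have h := aeval_algHom_apply (LinearMap.toMatrixAlgEquiv b₂).toAlgHom φ₂ p
    rw [hann p, map_zero] at h
    exact h

end BlockDiagonalization

/-! ### Transfer functions under equivalence and direct sums -/

namespace DescriptorSystem

section Algebra

variable {ι κ : Type} {p m : ℕ}

theorem map_ofReal_mul {α β γ : Type*} [Fintype β] (M : Matrix α β ℝ) (N : Matrix β γ ℝ) :
    (M * N).map Complex.ofReal = M.map Complex.ofReal * N.map Complex.ofReal :=
  Matrix.map_mul (f := Complex.ofRealHom)

theorem pencil_transform [Fintype ι] (P : Matrix ι ι ℝ) (S : DescriptorSystem ι p m)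
    (Q : Matrix ι ι ℝ) (s : ℂ) : (transform P S Q).pencil s =
      P.map Complex.ofReal * S.pencil s * Q.map Complex.ofReal := by
  simp only [pencil, transform, map_ofReal_mul, Matrix.mul_sub, Matrix.sub_mul, Matrix.mul_smul,
    Matrix.smul_mul]

theorem pencil_reindex (e : ι ≃ κ) (S : DescriptorSystem ι p m) (s : ℂ) :
    (S.reindex e).pencil s = (S.pencil s).submatrix e.symm e.symm :=
  rfl

theorem pencil_directSum (S₁ : DescriptorSystem ι p m) (S₂ : DescriptorSystem κ p m) (s : ℂ) :
    (S₁.directSum S₂).pencil s = Matrix.fromBlocks (S₁.pencil s) 0 0 (S₂.pencil s) := by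
  ext (i | i) (j | j) <;> simp [pencil, directSum]

theorem isUnit_map_ofReal [Fintype ι] [DecidableEq ι] {M : Matrix ι ι ℝ} (hM : IsUnit M) :
    IsUnit (M.map Complex.ofReal) :=
  hM.map Complex.ofRealHom.mapMatrix

variable [Fintype ι] [DecidableEq ι] [Fintype κ] [DecidableEq κ]

theorem transferFunction_transform {P Q : Matrix ι ι ℝ} (hP : IsUnit P) (hQ : IsUnit Q)
    (S : DescriptorSystem ι p m) : (transform P S Q).transferFunction = S.transferFunction := by
  funext s
  have hP' := (Matrix.isUnit_iff_isUnit_det _).1 (isUnit_map_ofReal hP)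
  have hQ' := (Matrix.isUnit_iff_isUnit_det _).1 (isUnit_map_ofReal hQ)
  simp only [transferFunction, pencil_transform, Matrix.mul_inv_rev]
  simp only [transform, map_ofReal_mul, Matrix.mul_assoc]
  rw [Matrix.nonsing_inv_mul_cancel_left _ _ hP', Matrix.mul_nonsing_inv_cancel_left _ _ hQ']

theorem resolventSet_transform {P Q : Matrix ι ι ℝ} (hP : IsUnit P) (hQ : IsUnit Q)
    (S : DescriptorSystem ι p m) : (transform P S Q).resolventSet = S.resolventSet := by
  ext s
  have hP' := ((Matrix.isUnit_iff_isUnit_det _).1 (isUnit_map_ofReal hP)).ne_zero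
  have hQ' := ((Matrix.isUnit_iff_isUnit_det _).1 (isUnit_map_ofReal hQ)).ne_zero
  simp [resolventSet, pencil_transform, Matrix.det_mul, hP', hQ']

theorem resolventSet_reindex (e : ι ≃ κ) (S : DescriptorSystem ι p m) :
    (S.reindex e).resolventSet = S.resolventSet := by
  ext s
  simp [resolventSet, pencil_reindex]

theorem transferFunction_reindex (e : ι ≃ κ) (S : DescriptorSystem ι p m) :
    (S.reindex e).transferFunction = S.transferFunction := by
  funext s
  have hC : (S.reindex e).C.map Complex.ofReal = (S.C.map Complex.ofReal).submatrix id e.symm := rfl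
  have hB : (S.reindex e).B.map Complex.ofReal = (S.B.map Complex.ofReal).submatrix e.symm id := rfl
  have hD : (S.reindex e).D = S.D := rfl
  simp only [transferFunction, pencil_reindex, Matrix.inv_submatrix_equiv, hC, hB, hD,
    Matrix.submatrix_mul_equiv, Matrix.submatrix_id_id]

theorem resolventSet_directSum (S₁ : DescriptorSystem ι p m) (S₂ : DescriptorSystem κ p m) :
    (S₁.directSum S₂).resolventSet = S₁.resolventSet ∩ S₂.resolventSet := by
  ext s
  simp [resolventSet, pencil_directSum]

theorem transferFunction_directSum (S₁ : DescriptorSystem ι p m) (S₂ : DescriptorSystem κ p m)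
    {s : ℂ} (h₁ : s ∈ S₁.resolventSet) (h₂ : s ∈ S₂.resolventSet) :
    (S₁.directSum S₂).transferFunction s = S₁.transferFunction s + S₂.transferFunction s := by
  have hinv : ((S₁.directSum S₂).pencil s)⁻¹ =
      Matrix.fromBlocks (S₁.pencil s)⁻¹ 0 0 (S₂.pencil s)⁻¹ := by
    refine Matrix.inv_eq_right_inv ?_
    rw [pencil_directSum, Matrix.fromBlocks_multiply]
    simp [Matrix.mul_nonsing_inv _ (isUnit_iff_ne_zero.2 h₁),
      Matrix.mul_nonsing_inv _ (isUnit_iff_ne_zero.2 h₂)]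
  have hC : (S₁.directSum S₂).C.map Complex.ofReal =
      Matrix.fromCols (S₁.C.map Complex.ofReal) (S₂.C.map Complex.ofReal) := by
    ext i (j | j) <;> rfl
  have hB : (S₁.directSum S₂).B.map Complex.ofReal =
      Matrix.fromRows (S₁.B.map Complex.ofReal) (S₂.B.map Complex.ofReal) := by
    ext (i | i) j <;> rfl
  have hD : (S₁.directSum S₂).D.map Complex.ofReal =
      S₁.D.map Complex.ofReal + S₂.D.map Complex.ofReal := by
    ext i j
    simp [directSum]
  simp only [transferFunction, hinv, hC, hB, hD, Matrix.fromCols_mul_fromBlocks, Matrix.mul_zero,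
    add_zero, zero_add, Matrix.fromCols_mul_fromRows]
  abel

theorem RestrictedSystemEquivalent.resolventSet_eq {S : DescriptorSystem ι p m}
    {T : DescriptorSystem κ p m} (h : S.RestrictedSystemEquivalent T) :
    S.resolventSet = T.resolventSet := by
  obtain ⟨e, P, Q, hP, hQ, rfl⟩ := h
  rw [resolventSet_transform hP hQ, resolventSet_reindex]

theorem RestrictedSystemEquivalent.transferFunction_eq {S : DescriptorSystem ι p m}
    {T : DescriptorSystem κ p m} (h : S.RestrictedSystemEquivalent T) :
    S.transferFunction = T.transferFunction := by
  obtain ⟨e, P, Q, hP, hQ, rfl⟩ := h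
  rw [transferFunction_transform hP hQ, transferFunction_reindex]

end Algebra

end DescriptorSystem

/-! ### Existence of the decomposition -/

namespace DescriptorSystem

open Polynomial

/-- Since `0` is not an eigenvalue, `A` is invertible, and the generalized eigenvalues of `(E, A)`
are the inverses of the nonzero eigenvalues of `A⁻¹ E`. Inversion preserves the sign of the real
part, so that splitting the characteristic polynomial of `A⁻¹ E` by that sign separates the two
parts; the infinite eigenvalues, i.e. the zero eigenvalues of `A⁻¹ E`, go to the stable part. -/
theorem exists_stableAntistableDecomposition {n p m : ℕ} (S : DescriptorSystem (Fin n) p m)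
    (hS : S.HasNoImaginaryEigenvalue) :
    ∃ (a b : ℕ) (Splus : DescriptorSystem (Fin a) p m) (Sminus : DescriptorSystem (Fin b) p m),
      S.IsStableAntistableDecomposition Splus Sminus := by
  have hA : IsUnit S.A.det := by
    have h0 : (S.pencil 0).det ≠ 0 := hS.2 (by simp : (0 : ℂ) ∈ {s : ℂ | s.re = 0})
    rw [isUnit_iff_ne_zero]
    contrapose! h0
    have h1 : (S.A.map Complex.ofReal).det = 0 := by
      have := (Complex.ofRealHom.map_det S.A).symm
      rw [h0, map_zero] at this
      exact this
    simp [pencil, Matrix.det_neg, h1]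
  obtain ⟨r, t, hrt, hr, ht⟩ := exists_factor_re_pos (S.A⁻¹ * S.E).charpoly
    (S.A⁻¹ * S.E).charpoly_monic.ne_zero
  have hcop : IsCoprime r t := by
    refine (isCoprime_iff_aeval_ne_zero_of_isAlgClosed (k := ℝ) ℂ r t).2 ?_
    intro z
    by_contra! h
    exact absurd (ht z h.2) (not_le.2 (hr z h.1))
  obtain ⟨a, b, e, P, Q, N₁, N₂, hPQ, hblock, hN₁, hN₂⟩ :=
    exists_blockDiagonalization (S.A⁻¹ * S.E) hcop (by rw [← hrt, Matrix.aeval_self_charpoly])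
  set A' := S.A.submatrix e.symm e.symm with hA'
  have hAinv : A'⁻¹ * A' = 1 := by
    rw [hA', Matrix.inv_submatrix_equiv, Matrix.submatrix_mul_equiv, Matrix.nonsing_inv_mul _ hA,
      Matrix.submatrix_one_equiv]
  have hQP : Q * P = 1 := mul_eq_one_comm.1 hPQ
  have hMsub : (S.A⁻¹ * S.E).submatrix e.symm e.symm = A'⁻¹ * S.E.submatrix e.symm e.symm := by
    rw [hA', Matrix.inv_submatrix_equiv, Matrix.submatrix_mul_equiv]
  set B' := P * A'⁻¹ * S.B.submatrix e.symm id
  set C' := S.C.submatrix id e.symm * Q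
  set Splus : DescriptorSystem (Fin a) p m := ⟨N₁, 1, B'.toRows₁, C'.toCols₁, S.D⟩
  set Sminus : DescriptorSystem (Fin b) p m := ⟨N₂, 1, B'.toRows₂, C'.toCols₂, 0⟩
  have hequiv : S.RestrictedSystemEquivalent (Splus.directSum Sminus) := by
    refine ⟨e, P * A'⁻¹, Q, ?_, IsUnit.of_mul_eq_one _ hQP, ?_⟩
    · exact (IsUnit.of_mul_eq_one _ hPQ).mul (IsUnit.of_mul_eq_one _ hAinv)
    · simp only [Splus, Sminus, transform, reindex, directSum, Matrix.fromRows_toRows,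
        Matrix.fromCols_toCols, add_zero, mk.injEq, and_true]
      refine ⟨?_, ?_, rfl, rfl⟩
      · rw [Matrix.mul_assoc P, ← hMsub, hblock]
      · rw [← hA', Matrix.mul_assoc P, hAinv, Matrix.mul_one, hPQ, Matrix.fromBlocks_one]
  have hsplus : {s : ℂ | 0 ≤ s.re} ⊆ Splus.resolventSet := by
    intro s hs hdet
    obtain ⟨hs0, hroot⟩ := aeval_inv_eq_zero_of_det_eq_zero hN₁ hdet
    have hre := ht _ hroot
    rw [Complex.inv_re] at hre
    have hs' : s.re ≤ 0 := by
      by_contra! hpos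
      exact absurd hre (not_le.2 (div_pos hpos (Complex.normSq_pos.2 hs0)))
    have hmem := hS.2 (le_antisymm hs' hs : s ∈ {s : ℂ | s.re = 0})
    rw [hequiv.resolventSet_eq, resolventSet_directSum] at hmem
    exact hmem.1 hdet
  have hsminus : {s : ℂ | s.re ≤ 0} ⊆ Sminus.resolventSet := by
    intro s hs hdet
    obtain ⟨hs0, hroot⟩ := aeval_inv_eq_zero_of_det_eq_zero hN₂ hdet
    have hre := hr _ hroot
    rw [Complex.inv_re] at hre
    exact absurd hs (not_le.2 ((div_pos_iff_of_pos_right (Complex.normSq_pos.2 hs0)).1 hre))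
  -- `0` is not a root of `r`, so `r(N₂) = 0` expresses the inverse of `N₂` as a polynomial in `N₂`
  have hN₂unit : IsUnit N₂ := by
    have hr0 : r.coeff 0 ≠ 0 := by
      intro h0
      have := hr 0 (by rw [← coeff_zero_eq_aeval_zero', h0, map_zero])
      simp at this
    have h1 := hN₂
    rw [← X_mul_divX_add r, map_add, map_mul, aeval_X, aeval_C, add_eq_zero_iff_eq_neg,
      Algebra.algebraMap_eq_smul_one] at h1
    refine IsUnit.of_mul_eq_one (-(r.coeff 0)⁻¹ • aeval N₂ r.divX) ?_
    rw [mul_smul_comm, h1, neg_smul_neg, smul_smul, inv_mul_cancel₀ hr0, one_smul]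
  exact ⟨a, b, Splus, Sminus, ⟨⟨0, hsplus (by simp)⟩, hsplus⟩,
    ⟨⟨0, hsminus (by simp)⟩, hsminus, hN₂unit⟩, rfl, hequiv⟩

end DescriptorSystem

/-! ### The L₂-norm of matrix-valued functions -/

section MatrixNorm

open MeasureTheory

attribute [local instance] Matrix.frobeniusNormedAddCommGroup

variable {p m : ℕ}

theorem frobenius_enorm_sq (M : Matrix (Fin p) (Fin m) ℂ) :
    ‖M‖ₑ ^ 2 = ∑ i, ∑ j, ‖M i j‖ₑ ^ 2 := by
  have h : ‖M‖₊ ^ 2 = ∑ i, ∑ j, ‖M i j‖₊ ^ 2 := by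
    rw [Matrix.frobenius_nnnorm_def, ← NNReal.rpow_natCast, ← NNReal.rpow_mul]
    norm_num
  simp only [enorm_eq_nnnorm]
  exact_mod_cast congrArg ((↑) : NNReal → ℝ≥0∞) h

theorem l2Norm_congr {G H : ℂ → Matrix (Fin p) (Fin m) ℂ}
    (h : ∀ ω : ℝ, G (Complex.I * ω) = H (Complex.I * ω)) : l2Norm G = l2Norm H := by
  simp only [l2Norm, h]

/-- The energy of `G` on the imaginary axis, entry by entry: `2π ‖G‖₂²`. -/
noncomputable def axisEnergy (G : ℂ → Matrix (Fin p) (Fin m) ℂ) : ℝ≥0∞ :=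
  ∑ i, ∑ j, ∫⁻ ω : ℝ, ‖G (Complex.I * ω) i j‖ₑ ^ 2

theorem l2Norm_eq_axisEnergy {G : ℂ → Matrix (Fin p) (Fin m) ℂ}
    (hG : ∀ i j, Continuous fun ω : ℝ => G (Complex.I * ω) i j) :
    l2Norm G = (ENNReal.ofReal (1 / (2 * Real.pi)) * axisEnergy G) ^ (1 / 2 : ℝ) := by
  have hmeas : ∀ i j, Measurable fun ω : ℝ => ‖G (Complex.I * ω) i j‖ₑ ^ 2 := fun i j =>
    (hG i j).measurable.enorm.pow_const 2
  simp only [l2Norm, axisEnergy, frobenius_enorm_sq]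
  rw [lintegral_finsetSum _ fun i _ => Finset.measurable_sum _ fun j _ => hmeas i j]
  simp_rw [lintegral_finsetSum _ fun j _ => hmeas _ j]

theorem normalization_ne_zero : ENNReal.ofReal (1 / (2 * Real.pi)) ≠ 0 := by
  simp [Real.pi_pos]

end MatrixNorm

/-! ### Transfer functions of stable and antistable systems -/

namespace DescriptorSystem

open Polynomial Filter MeasureTheory Topology Bornology

section Rational

variable {ι κ : Type} [Fintype ι] [DecidableEq ι] [Fintype κ] [DecidableEq κ] {p m : ℕ}

/-- By Cramer's rule the entries of a transfer function are rational with denominator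
`det (s E - A)`. -/
theorem isRationalOn_transferFunction (S : DescriptorSystem ι p m) (i : Fin p) (j : Fin m) :
    IsRationalOn (fun s => S.transferFunction s i j) S.resolventSet := by
  set L : Matrix ι ι ℂ[X] :=
    (X : ℂ[X]) • S.E.map (fun x : ℝ => Polynomial.C (x : ℂ)) -
      S.A.map (fun x : ℝ => Polynomial.C (x : ℂ))
  have hL : ∀ s : ℂ, (evalRingHom s).mapMatrix L = S.pencil s := by
    intro s
    ext k l
    simp [L, pencil]
    exact mul_comm _ _
  have hdet : ∀ s : ℂ, L.det.eval s = (S.pencil s).det := by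
    intro s
    rw [← hL, ← RingHom.map_det, coe_evalRingHom]
  have hadj : ∀ (s : ℂ) (k l : ι), (L.adjugate k l).eval s = (S.pencil s).adjugate k l := by
    intro s k l
    rw [← hL, ← RingHom.map_adjugate]
    simp
  refine ⟨(∑ k, (∑ l, Polynomial.C (S.C i l : ℂ) * L.adjugate l k) * Polynomial.C (S.B k j : ℂ))
    + Polynomial.C (S.D i j : ℂ) * L.det, L.det, fun s hs => ?_⟩
  have hs' : (S.pencil s).det ≠ 0 := hs
  rw [hdet]
  refine ⟨hs', ?_⟩
  simp only [transferFunction, Matrix.inv_def, Ring.inverse_eq_inv', eval_add, eval_finsetSum,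
    eval_mul, eval_C, hdet, hadj]
  rw [Matrix.mul_smul, Matrix.smul_mul, add_div, mul_div_cancel_right₀ _ hs']
  simp [Matrix.mul_apply, div_eq_inv_mul]

/-- The transfer function `C (s E - A)⁻¹ B` of an antistable system without feedthrough is square
integrable on the imaginary axis: `s G(s) = C (E - s⁻¹ A)⁻¹ B` tends to `C E⁻¹ B` at infinity. -/
theorem IsAntistable.lintegral_ne_top {S : DescriptorSystem ι p m} (hS : S.IsAntistable)
    (hD : S.D = 0) (i : Fin p) (j : Fin m) :
    ∫⁻ ω : ℝ, ‖S.transferFunction (Complex.I * ω) i j‖ₑ ^ 2 ≠ ∞ := by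
  have hU : {s : ℂ | s.re = 0} ⊆ S.resolventSet := fun s hs => hS.2.1 (le_of_eq hs)
  set M : ℂ → Matrix ι ι ℂ := fun t => S.E.map Complex.ofReal - t • S.A.map Complex.ofReal with hM
  set F : ℂ → ℂ := fun t => (S.C.map Complex.ofReal * (M t)⁻¹ * S.B.map Complex.ofReal) i j with hF
  have hcont : ContinuousAt F 0 := by
    have hMc : Continuous M := by fun_prop
    have hdet0 : (M 0).det ≠ 0 := by
      have := (Matrix.isUnit_iff_isUnit_det _).1 (isUnit_map_ofReal hS.2.2)
      simpa [hM] using this.ne_zero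
    have hinv : ContinuousAt (fun t => (M t)⁻¹) 0 := by
      refine ContinuousAt.comp (f := M) (g := Inv.inv) ?_ hMc.continuousAt
      refine continuousAt_matrix_inv _ ?_
      rw [Ring.inverse_eq_inv']
      exact continuousAt_inv₀ hdet0
    have hmul : Continuous fun N : Matrix ι ι ℂ =>
        (S.C.map Complex.ofReal * N * S.B.map Complex.ofReal) i j :=
      ((continuous_const.matrix_mul continuous_id).matrix_mul continuous_const).matrix_elem i j
    exact hmul.continuousAt.comp hinv
  have hev : ∀ᶠ s in cobounded ℂ, s ≠ 0 ∧ ‖F s⁻¹‖ < ‖F 0‖ + 1 := by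
    refine (eventually_ne_cobounded 0).and ?_
    exact (hcont.norm.tendsto.comp tendsto_inv₀_cobounded).eventually (gt_mem_nhds (lt_add_one _))
  rw [← comap_norm_atTop, eventually_comap] at hev
  obtain ⟨R, hR⟩ := eventually_atTop.1 hev
  refine lintegral_sq_ne_top_of_decay (c := ‖F 0‖ + 1) (R := R)
    ((S.isRationalOn_transferFunction i j).continuous_axis hU) fun ω hω => ?_
  set s : ℂ := Complex.I * ω with hs
  have hnorm : ‖s‖ = |ω| := by simp [hs]
  obtain ⟨hs0, hFs⟩ := hR |ω| hω s hnorm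
  have hpen : S.pencil s = s • M s⁻¹ := by
    simp [hM, pencil, smul_sub, smul_smul, mul_inv_cancel₀ hs0]
  have hMu : IsUnit (M s⁻¹).det := by
    have hdet : (S.pencil s).det ≠ 0 := hU (by simp [hs])
    rw [hpen, Matrix.det_smul] at hdet
    exact isUnit_iff_ne_zero.2 (right_ne_zero_of_mul hdet)
  have hpinv : (S.pencil s)⁻¹ = s⁻¹ • (M s⁻¹)⁻¹ := by
    refine Matrix.inv_eq_right_inv ?_
    rw [hpen, Matrix.smul_mul, Matrix.mul_smul, Matrix.mul_nonsing_inv _ hMu, smul_smul,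
      mul_inv_cancel₀ hs0, one_smul]
  have hG : S.transferFunction s i j = s⁻¹ * F s⁻¹ := by
    simp [transferFunction, hpinv, hF, hD]
  rw [hG, ← hnorm, norm_mul, norm_inv, mul_right_comm, inv_mul_cancel₀ (norm_ne_zero_iff.2 hs0),
    one_mul]
  exact hFs.le

theorem IsStable.axis_subset_resolventSet {S : DescriptorSystem ι p m} (hS : S.IsStable) :
    {s : ℂ | s.re = 0} ⊆ S.resolventSet := fun _ hs => hS.2 (ge_of_eq hs)

/-- The error of a stable approximant `T` splits orthogonally into the antistable part of `S` and
the error of `T` as an approximant of the stable part of `S`. -/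
theorem axisEnergy_error {T : DescriptorSystem ι p m} {S₁ : DescriptorSystem κ p m}
    {ν : Type} [Fintype ν] [DecidableEq ν] {S₂ : DescriptorSystem ν p m}
    (hT : T.IsStable) (h₁ : S₁.IsStable) (h₂ : S₂.IsAntistable) (hD : S₂.D = 0) :
    axisEnergy (S₂.transferFunction + (S₁.transferFunction - T.transferFunction)) =
      axisEnergy S₂.transferFunction + axisEnergy (S₁.transferFunction - T.transferFunction) := by
  have h : ∀ i j, ∫⁻ ω : ℝ, ‖S₂.transferFunction (Complex.I * ω) i j +
      (S₁.transferFunction (Complex.I * ω) i j - T.transferFunction (Complex.I * ω) i j)‖ₑ ^ 2 =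
      (∫⁻ ω : ℝ, ‖S₂.transferFunction (Complex.I * ω) i j‖ₑ ^ 2) +
        ∫⁻ ω : ℝ, ‖S₁.transferFunction (Complex.I * ω) i j -
          T.transferFunction (Complex.I * ω) i j‖ₑ ^ 2 := fun i j =>
    lintegral_sq_add (g := fun s => S₂.transferFunction s i j)
      (h := fun s => S₁.transferFunction s i j - T.transferFunction s i j)
      ((S₂.isRationalOn_transferFunction i j).mono h₂.2.1)
      (((S₁.isRationalOn_transferFunction i j).mono h₁.2).sub
        ((T.isRationalOn_transferFunction i j).mono hT.2)) (h₂.lintegral_ne_top hD i j)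
  simp only [axisEnergy, Pi.add_apply, Pi.sub_apply, Matrix.add_apply, Matrix.sub_apply, h,
    Finset.sum_add_distrib]

theorem IsAntistable.axisEnergy_ne_top {S : DescriptorSystem ι p m} (hS : S.IsAntistable)
    (hD : S.D = 0) : axisEnergy S.transferFunction ≠ ∞ :=
  ENNReal.sum_ne_top.2 fun i _ => ENNReal.sum_ne_top.2 fun j _ => hS.lintegral_ne_top hD i j

/-- Two stable systems whose transfer functions have `L₂`-distance zero realize each other. -/
theorem isRealizationOf_of_axisEnergy_eq_zero {S : DescriptorSystem ι p m}
    {T : DescriptorSystem κ p m} (hS : S.IsStable) (hT : T.IsStable)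
    (h0 : axisEnergy (S.transferFunction - T.transferFunction) = 0) : T.IsRealizationOf S := by
  refine ⟨hT.1, fun s hs => ?_⟩
  ext i j
  have hsub : {s : ℂ | s.re = 0} ⊆ S.resolventSet ∩ T.resolventSet :=
    Set.subset_inter hS.axis_subset_resolventSet hT.axis_subset_resolventSet
  have hrat : IsRationalOn (fun s => S.transferFunction s i j - T.transferFunction s i j)
      (S.resolventSet ∩ T.resolventSet) :=
    ((S.isRationalOn_transferFunction i j).mono Set.inter_subset_left).sub
      ((T.isRationalOn_transferFunction i j).mono Set.inter_subset_right)
  have hij : ∫⁻ ω : ℝ, ‖(S.transferFunction - T.transferFunction) (Complex.I * ω) i j‖ₑ ^ 2 = 0 :=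
    Finset.sum_eq_zero_iff.1 (Finset.sum_eq_zero_iff.1 h0 i (Finset.mem_univ i)) j
      (Finset.mem_univ j)
  have hc := hrat.continuous_axis hsub
  simp only [Pi.sub_apply, Matrix.sub_apply] at hij
  rw [lintegral_eq_zero_iff (hc.measurable.enorm.pow_const 2)] at hij
  have hae : (fun ω : ℝ => S.transferFunction (Complex.I * ω) i j -
      T.transferFunction (Complex.I * ω) i j) =ᵐ[volume] fun _ => 0 := by
    filter_upwards [hij] with ω hω
    simpa using hω
  have hall := (hc.ae_eq_iff_eq volume continuous_const).1 hae
  exact sub_eq_zero.1 (hrat.eq_zero_of_axis hsub (fun ω => congrFun hall ω) s hs)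

end Rational

end DescriptorSystem

/-! ### Optimality and uniqueness of the stable part -/

open DescriptorSystem in
theorem mainTheorem2 (n p m : ℕ) (S : DescriptorSystem (Fin n) p m)
    (hS : S.HasNoImaginaryEigenvalue) :
    (∃ (a b : ℕ) (Splus : DescriptorSystem (Fin a) p m) (Sminus : DescriptorSystem (Fin b) p m),
      S.IsStableAntistableDecomposition Splus Sminus) ∧
    ∀ (a b : ℕ) (Splus : DescriptorSystem (Fin a) p m) (Sminus : DescriptorSystem (Fin b) p m),
      S.IsStableAntistableDecomposition Splus Sminus →
        Splus.IsOptimalRH2Approximation S ∧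
        S.infStableL2Error = l2Norm (S.transferFunction - Splus.transferFunction) ∧
        l2Norm (S.transferFunction - Splus.transferFunction) = l2Norm Sminus.transferFunction ∧
        l2Norm Sminus.transferFunction ≠ ∞ ∧
        ∀ (k : ℕ) (T : DescriptorSystem (Fin k) p m),
          T.IsOptimalRH2Approximation S → T.IsRealizationOf Splus := by
  refine ⟨S.exists_stableAntistableDecomposition hS, ?_⟩
  rintro a b Splus Sminus ⟨hplus, hminus, hD, hequiv⟩
  have hGS : ∀ ω : ℝ, S.transferFunction (Complex.I * ω) =
      Splus.transferFunction (Complex.I * ω) + Sminus.transferFunction (Complex.I * ω) := fun ω => by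
    rw [hequiv.transferFunction_eq, transferFunction_directSum _ _ (hplus.axis_subset_resolventSet (by simp))
      (hminus.2.1 (by simp))]
  have haxis : ∀ {k : ℕ} (U : DescriptorSystem (Fin k) p m), {s : ℂ | s.re = 0} ⊆ U.resolventSet →
      ∀ i j, Continuous fun ω : ℝ => U.transferFunction (Complex.I * ω) i j := fun U hU i j =>
    (U.isRationalOn_transferFunction i j).continuous_axis hU
  have hminusAxis : {s : ℂ | s.re = 0} ⊆ Sminus.resolventSet := fun s hs => hminus.2.1 (le_of_eq hs)
  have hnormMinus := l2Norm_eq_axisEnergy (haxis Sminus hminusAxis)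
  have hfin := hminus.axisEnergy_ne_top hD
  have herr : ∀ {k : ℕ} (T : DescriptorSystem (Fin k) p m), T.IsStable →
      l2Norm (S.transferFunction - T.transferFunction) =
        (ENNReal.ofReal (1 / (2 * Real.pi)) * (axisEnergy Sminus.transferFunction +
          axisEnergy (Splus.transferFunction - T.transferFunction))) ^ (1 / 2 : ℝ) := by
    intro k T hT
    rw [← axisEnergy_error hT hplus hminus hD, ← l2Norm_eq_axisEnergy fun i j =>
      (haxis Sminus hminusAxis i j).add
        ((haxis Splus hplus.axis_subset_resolventSet i j).sub (haxis T hT.axis_subset_resolventSet i j))]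
    refine l2Norm_congr fun ω => ?_
    simp only [Pi.add_apply, Pi.sub_apply, hGS]
    abel
  have hopt : l2Norm (S.transferFunction - Splus.transferFunction) =
      l2Norm Sminus.transferFunction := l2Norm_congr fun ω => by simp [hGS]
  have hinf : S.infStableL2Error = l2Norm (S.transferFunction - Splus.transferFunction) := by
    refine le_antisymm (iInf₂_le_of_le a Splus (iInf_le _ hplus)) ?_
    refine le_iInf fun k => le_iInf₂ fun T hT => ?_
    rw [hopt, herr T hT, hnormMinus]
    gcongr
    exact le_self_add
  refine ⟨⟨hplus, hinf.symm⟩, hinf, hopt, ?_, ?_⟩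
  · rw [hnormMinus]
    exact ENNReal.rpow_ne_top_of_nonneg (by norm_num)
      (ENNReal.mul_ne_top ENNReal.ofReal_ne_top hfin)
  · rintro k T ⟨hT, hTopt⟩
    refine isRealizationOf_of_axisEnergy_eq_zero hplus hT ?_
    rw [hinf, hopt, hnormMinus, herr T hT] at hTopt
    have h1 := ENNReal.rpow_left_injective (by norm_num : (1 / 2 : ℝ) ≠ 0) hTopt
    have h2 := (ENNReal.mul_right_inj normalization_ne_zero ENNReal.ofReal_ne_top).1 h1
    exact (ENNReal.add_right_inj hfin).1 (h2.trans (add_zero _).symm)
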